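/- Let $f$ be a (Borel measurable) probability density on $\mathbb{R}$ that is continuous when restricted to its support $\{f\neq 0\}$. Fix $f_{\min}>0$, put $U=\{x\in\mathbb{R}: f(x)\ge f_{\min}\}$ and let $v_U$ be the Lebesgue measure of $U$, which is finite. For data points $x_1,\dots,x_n\in\mathbb{R}$, the leapfrog distance $\mathrm{LF}(x_i,x_j)$ is the least total cost of a path from $i$ to $j$ in the complete graph on $\{1,\dots,n\}$ in which the edge $\{k,l\}$ has cost $|x_k-x_l|^2$. Let $X_1,\dots,X_n$ be i.i.d. with density $f$, and let $\mathbb{E}[\mathrm{LF}(a,b)]$ be the expected leapfrog distance between two of these samples, given that their values are $a$ and $b$ (so that the other $n-2$ samples are i.i.d. with density $f$). Then, as $n\to\infty$, $$\mathbb{E}[\mathrm{LF}(a,b)]=\frac{2}{n}\int_a^b\frac{dx}{f(x)}+R_n(a,b),\qquad R_n(a,b)=o(1/n),$$ uniformly over all $a<b$ with $[a,b]\subseteq U$. If moreover, for some constant $L$, $f$ is locally $L$-Lipschitz on $U$ (every point of $U$ has a neighbourhood in $U$ on which $f$ is $L$-Lipschitz), then there is an $n_0$, depending only on $f$, $f_{\min}$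 and $L$, such that $|R_n(a,b)|\le 10\,n^{-1.5}\,v_U^2$ for all $n\ge n_0$ and all $a<b$ with $[a,b]\subseteq U$. -/

import Mathlib

open MeasureTheory Set Filter Topology
open scoped NNReal ENNReal

/-- Total cost of a walk, each edge `u v` being charged `c u v`. -/
def walkCost {V : Type*} {G : SimpleGraph V} (c : V → V → ℝ) :
    {u v : V} → G.Walk u v → ℝ
  | _, _, SimpleGraph.Walk.nil => 0
  | u, _, SimpleGraph.Walk.cons (v := w) _ p => c u w + walkCost c p

/-- The leapfrog distance between the data points `p i` and `p j`: the cost of a cheapest walk from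
`i` to `j` in the complete graph on the data points, where the edge between two data points costs
the square of their distance. -/
noncomputable def leapfrogDist {ι E : Type*} [PseudoMetricSpace E] (p : ι → E) (i j : ι) : ℝ :=
  ⨅ w : (⊤ : SimpleGraph ι).Walk i j, walkCost (fun k l => dist (p k) (p l) ^ 2) w

/-- `f` is a probability density function on the real line. -/
structure IsProbDensity (f : ℝ → ℝ) : Prop where
  measurable : Measurable f
  nonneg : ∀ x, 0 ≤ f x
  lintegral_eq_one : ∫⁻ x, ENNReal.ofReal (f x) = 1

/-- The joint law on `ℝⁿ` of `n` i.i.d. samples from the density `f`. -/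
noncomputable def sampleLaw (f : ℝ → ℝ) (n : ℕ) : Measure (Fin n → ℝ) :=
  Measure.pi fun _ => (volume : Measure ℝ).withDensity fun x => ENNReal.ofReal (f x)

/-- The leapfrog distance between samples `i` and `j`, when the `i`-th of the data points `x` takes
the value `a` and the `j`-th takes the value `b`. -/
noncomputable def leapfrogGiven {n : ℕ} (i j : Fin n) (a b : ℝ) (x : Fin n → ℝ) : ℝ :=
  leapfrogDist (Function.update (Function.update x i a) j b) i j

/-- The expected leapfrog distance between two samples `a` and `b` in a sample of size `n` from the
density `f`, where `a` is the `i`-th and `b` the `j`-th sample. The samples being independent, the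
remaining `n - 2` samples are i.i.d. with density `f` given the values `a` and `b`. -/
noncomputable def expectedLeapfrog (f : ℝ → ℝ) (n : ℕ) (i j : Fin n) (a b : ℝ) : ℝ :=
  ∫ x, leapfrogGiven i j a b x ∂(sampleLaw f n)

/-- The superlevel set `{x | f x ≥ c}`. -/
def superlevel (f : ℝ → ℝ) (c : ℝ) : Set ℝ := {x | c ≤ f x}

/-- `f` is locally Lipschitz on `s` with the constant `L`: each point of `s` has a neighbourhood in
`s` on which `f` is `L`-Lipschitz. -/
def LocallyLipschitzOnWith (L : ℝ≥0) (f : ℝ → ℝ) (s : Set ℝ) : Prop :=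
  ∀ x ∈ s, ∃ t ∈ 𝓝[s] x, LipschitzOnWith L f t

/-!
On the line a cheapest path from `a` to `b` visits every data point in between, since splitting an
edge at an intermediate point lowers the sum of squares. The square of a gap is twice the area of
the triangle of the pairs `x < y` inside it, so the leapfrog distance is twice the area of the set
of the pairs `a ≤ x < y ≤ b` that are not separated by a data point
(`leapfrogDist_eq_volume_gapPairs`). Tonelli's theorem turns this into an exact formula for the
expectation (`expectedLeapfrog_eq`): with `F x y` the integral of `f` over `[x, y]`, it is
`2 ∫_a^b ∫_x^b (1 - F x y) ^ (n - 2) dy dx`. The factor `1 - F x y` is called the vacancy below.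

Where `f ≥ c` the vacancy is at most `exp (-c (y - x))`, so only the `y` at a distance `O(1/n)` from
`x` matter, and the inner integral is about `1 / (n f x)`. For the uniform `o(1/n)`, the inner
integral, rescaled, is compared with an integral `scaledGap` that does not depend on `b`. The
comparison costs an exponentially decaying tail, whose integral over `x` is `O(1/n)`. At every
Lebesgue point of `{f ≥ c}` the function `scaledGap` tends to `1 / f`, and it is bounded by `1 / c`;
as `{f ≥ c}` has finite measure, the convergence takes place in `L¹`
(`tendsto_setIntegral_abs_scaledGap_sub`), which bounds the remainder for all intervals at once.

In the Lipschitz case, the fundamental theorem of calculus evaluates the integral of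
`f y * (1 - F x y) ^ m` exactly (`integral_mul_vacancy_pow`). Replacing `f y` by `f x` there shows
that the remainder is `O(1/n²)`, with a constant that depends on `f`, `c` and `L` only. This is less than
`10 n^(-3/2) v²` for large `n`, where `v` is the measure of `{f ≥ c}`, which is positive as soon as
there is an interval to consider.
-/

/-! ### The leapfrog distance as an area -/

/-- The triangle of the pairs `x < y` of points between `s` and `t`. -/
def orderedPairs (s t : ℝ) : Set (ℝ × ℝ) :=
  {q | q.1 < q.2 ∧ q.1 ∈ uIcc s t ∧ q.2 ∈ uIcc s t}

/-- The pairs `x < y` of points between `s` and `t` that are not separated by a data point. -/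
def gapPairs {ι : Type*} (p : ι → ℝ) (s t : ℝ) : Set (ℝ × ℝ) :=
  {q | q ∈ orderedPairs s t ∧ ∀ k, p k ∉ Ioo q.1 q.2}

lemma orderedPairs_comm (s t : ℝ) : orderedPairs s t = orderedPairs t s := by
  simp only [orderedPairs, uIcc_comm]

lemma measurableSet_orderedPairs (s t : ℝ) : MeasurableSet (orderedPairs s t) :=
  (measurableSet_lt measurable_fst measurable_snd).inter
    ((measurable_fst measurableSet_uIcc).inter (measurable_snd measurableSet_uIcc))

lemma measurableSet_gapPairs {ι : Type*} [Countable ι] (p : ι → ℝ) (s t : ℝ) :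
    MeasurableSet (gapPairs p s t) := by
  refine (measurableSet_orderedPairs s t).inter (measurableSet_setOfPred.2 ?_)
  refine Measurable.forall fun k => measurableSet_setOfPred.1 (MeasurableSet.compl ?_)
  exact (measurableSet_lt measurable_fst measurable_const).inter
    (measurableSet_lt measurable_const measurable_snd)

lemma volume_orderedPairs (s t : ℝ) :
    volume (orderedPairs s t) = ENNReal.ofReal (dist s t ^ 2 / 2) := by
  wlog h : s ≤ t generalizing s t
  · rw [orderedPairs_comm, dist_comm, this t s (le_of_not_ge h)]
  have hsec : ∀ x, volume (Prod.mk x ⁻¹' orderedPairs s t)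
      = (Icc s t).indicator (fun x => ENNReal.ofReal (t - x)) x := by
    intro x
    by_cases hx : x ∈ Icc s t
    · rw [indicator_of_mem hx, ← Real.volume_Ioc]
      congr 1
      ext y
      simp only [orderedPairs, uIcc_of_le h, mem_preimage, mem_ofPred_eq, mem_Icc, mem_Ioc] at hx ⊢
      grind
    · rw [indicator_of_notMem hx]
      convert measure_empty (μ := volume (α := ℝ))
      ext y
      simp [orderedPairs, uIcc_of_le h] at hx ⊢
      grind
  rw [Measure.volume_eq_prod, Measure.prod_apply (measurableSet_orderedPairs s t)]
  simp_rw [hsec]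
  rw [lintegral_indicator measurableSet_Icc, ← ofReal_integral_eq_lintegral_ofReal,
    integral_Icc_eq_integral_Ioc, ← intervalIntegral.integral_of_le h]
  · congr 1
    rw [intervalIntegral.integral_comp_sub_left (fun x => x) t, Real.dist_eq, sq_abs]
    simp
    ring
  · exact (continuous_const.sub continuous_id).continuousOn.integrableOn_Icc
  · filter_upwards [ae_restrict_mem measurableSet_Icc] with x hx
    simpa using hx.2

lemma walkCost_nonneg {V : Type*} {G : SimpleGraph V} {c : V → V → ℝ} (hc : ∀ u v, 0 ≤ c u v)
    {u v : V} (w : G.Walk u v) : 0 ≤ walkCost c w := by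
  induction w with
  | nil => exact le_rfl
  | cons _ _ ih => exact add_nonneg (hc _ _) ih

lemma walkCost_append {V : Type*} {G : SimpleGraph V} (c : V → V → ℝ) {u v w : V}
    (p : G.Walk u v) (q : G.Walk v w) :
    walkCost c (p.append q) = walkCost c p + walkCost c q := by
  induction p with
  | nil => simp [walkCost]
  | cons _ _ ih => simp [walkCost, ih, add_assoc]

/-- A pair that is not separated by the data and that a walk passes over is passed over by one of
its edges, so the triangles over the edges cover the pairs counted. -/
lemma volume_gapPairs_le_walkCost {ι : Type*} (p : ι → ℝ) {i j : ι}
    (w : (⊤ : SimpleGraph ι).Walk i j) :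
    volume (gapPairs p (p i) (p j)) ≤
      ENNReal.ofReal (walkCost (fun k l => dist (p k) (p l) ^ 2) w / 2) := by
  induction w with
  | @nil u =>
    have h : gapPairs p (p u) (p u) = ∅ := eq_empty_of_forall_notMem fun q hq => by
      obtain ⟨⟨h1, h2, h3⟩, -⟩ := hq
      rw [uIcc_self, mem_singleton_iff] at h2 h3
      exact h1.ne (h2.trans h3.symm)
    simp [h]
  | @cons u m v h w ih =>
    have hsub : gapPairs p (p u) (p v) ⊆ orderedPairs (p u) (p m) ∪ gapPairs p (p m) (p v) := by
      rintro q ⟨⟨h1, h2, h3⟩, h4⟩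
      have := h4 m
      simp only [mem_union, gapPairs, orderedPairs, mem_ofPred_eq, mem_uIcc, mem_Ioo] at *
      grind
    rw [walkCost, add_div, ENNReal.ofReal_add (by positivity)
      (div_nonneg (walkCost_nonneg (fun _ _ => by positivity) _) two_pos.le), ← volume_orderedPairs]
    exact (measure_mono hsub).trans ((measure_union_le _ _).trans (add_le_add_right ih _))

/-- The walk that jumps from data point to data point attains the area. -/
lemma exists_walkCost_le_volume_gapPairs {ι : Type*} [Finite ι] (p : ι → ℝ) (i j : ι)
    (hij : p i ≤ p j) :
    ∃ w : (⊤ : SimpleGraph ι).Walk i j,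
      ENNReal.ofReal (walkCost (fun k l => dist (p k) (p l) ^ 2) w / 2) ≤
        volume (gapPairs p (p i) (p j)) := by
  induction hN : {k | p k ∈ Ioo (p i) (p j)}.ncard using Nat.strong_induction_on
    generalizing i j with
  | _ N ih =>
    by_cases hm : ∃ m, p m ∈ Ioo (p i) (p j)
    · obtain ⟨m, him, hmj⟩ := hm
      have h1 : {k | p k ∈ Ioo (p i) (p m)}.ncard < N := by
        rw [← hN]
        refine Set.ncard_lt_ncard ⟨fun k hk => ⟨hk.1, hk.2.trans hmj⟩, fun h => ?_⟩ (toFinite _)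
        exact lt_irrefl _ (h (a := m) ⟨him, hmj⟩).2
      have h2 : {k | p k ∈ Ioo (p m) (p j)}.ncard < N := by
        rw [← hN]
        refine Set.ncard_lt_ncard ⟨fun k hk => ⟨him.trans hk.1, hk.2⟩, fun h => ?_⟩ (toFinite _)
        exact lt_irrefl _ (h (a := m) ⟨him, hmj⟩).1
      obtain ⟨w₁, hw₁⟩ := ih _ h1 i m him.le rfl
      obtain ⟨w₂, hw₂⟩ := ih _ h2 m j hmj.le rfl
      refine ⟨w₁.append w₂, ?_⟩
      rw [walkCost_append, add_div]
      refine ENNReal.ofReal_add_le.trans ((add_le_add hw₁ hw₂).trans ?_)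
      rw [← measure_union _ (measurableSet_gapPairs _ _ _)]
      · refine measure_mono ?_
        rintro q (⟨⟨h1, h2, h3⟩, h4⟩ | ⟨⟨h1, h2, h3⟩, h4⟩)
        all_goals
          refine ⟨⟨h1, ?_, ?_⟩, h4⟩ <;> simp only [mem_uIcc] at * <;> grind
      · refine Set.disjoint_left.2 ?_
        rintro q ⟨⟨h1, h2, h3⟩, -⟩ ⟨⟨-, h5, h6⟩, -⟩
        simp only [mem_uIcc] at *
        grind
    · push Not at hm
      have hgap : gapPairs p (p i) (p j) = orderedPairs (p i) (p j) := by
        refine Subset.antisymm (fun q hq => hq.1) fun q hq => ⟨hq, fun k hk => hm k ?_⟩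
        obtain ⟨-, h2, h3⟩ := hq
        rw [uIcc_of_le hij] at h2 h3
        exact ⟨h2.1.trans_lt hk.1, hk.2.trans_le h3.2⟩
      rw [hgap, volume_orderedPairs]
      obtain rfl | hne := eq_or_ne i j
      · exact ⟨.nil, by simp [walkCost]⟩
      · exact ⟨.cons ((SimpleGraph.top_adj i j).2 hne) .nil, by simp [walkCost]⟩

/-- Half of the leapfrog distance is the area of the set of the pairs of points in between that are
not separated by a data point. -/
theorem leapfrogDist_eq_volume_gapPairs {ι : Type*} [Finite ι] (p : ι → ℝ) (i j : ι)
    (hij : p i ≤ p j) :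
    leapfrogDist p i j = 2 * (volume (gapPairs p (p i) (p j))).toReal := by
  obtain ⟨w, hw⟩ := exists_walkCost_le_volume_gapPairs p i j hij
  have hfin : volume (gapPairs p (p i) (p j)) ≠ ∞ :=
    ((volume_gapPairs_le_walkCost p w).trans_lt ENNReal.ofReal_lt_top).ne
  have : Nonempty ((⊤ : SimpleGraph ι).Walk i j) := ⟨w⟩
  refine le_antisymm ?_ (le_ciInf fun w' => ?_)
  · refine (ciInf_le ⟨0, ?_⟩ w).trans ?_
    · rintro _ ⟨w', rfl⟩
      exact walkCost_nonneg (fun _ _ => by positivity) w'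
    · have := (ENNReal.ofReal_le_iff_le_toReal hfin).1 hw
      linarith
  · have := ENNReal.toReal_le_of_le_ofReal
      (div_nonneg (walkCost_nonneg (fun _ _ => by positivity) w') two_pos.le)
      (volume_gapPairs_le_walkCost p w')
    linarith

/-! ### The exact formula for the expectation -/

namespace IsProbDensity

variable {f : ℝ → ℝ}

lemma integrable (hf : IsProbDensity f) : Integrable f :=
  ⟨hf.measurable.aestronglyMeasurable, by
    rw [hasFiniteIntegral_iff_ofReal (ae_of_all _ hf.nonneg), hf.lintegral_eq_one]
    exact ENNReal.one_lt_top⟩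

lemma integral_eq_one (hf : IsProbDensity f) : ∫ x, f x = 1 := by
  rw [integral_eq_lintegral_of_nonneg_ae (ae_of_all _ hf.nonneg)
    hf.measurable.aestronglyMeasurable, hf.lintegral_eq_one, ENNReal.toReal_one]

lemma isProbabilityMeasure (hf : IsProbDensity f) :
    IsProbabilityMeasure ((volume : Measure ℝ).withDensity fun x => ENNReal.ofReal (f x)) :=
  ⟨by rw [withDensity_apply _ MeasurableSet.univ, Measure.restrict_univ, hf.lintegral_eq_one]⟩

end IsProbDensity

/-- The probability that a sample from the density `f` misses the interval from `x` to `y`. -/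
noncomputable def vacancy (f : ℝ → ℝ) (x y : ℝ) : ℝ := 1 - ∫ t in x..y, f t

section vacancy

variable {f : ℝ → ℝ}

lemma vacancy_eq (hf : IsProbDensity f) (x y : ℝ) :
    vacancy f x y = 1 - ((∫ t in (0 : ℝ)..y, f t) - ∫ t in (0 : ℝ)..x, f t) := by
  rw [vacancy, intervalIntegral.integral_interval_sub_left hf.integrable.intervalIntegrable
    hf.integrable.intervalIntegrable]

lemma continuous_vacancy (hf : IsProbDensity f) :
    Continuous fun q : ℝ × ℝ => vacancy f q.1 q.2 := by
  simp_rw [vacancy_eq hf]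
  have := intervalIntegral.continuous_primitive
    (fun _ _ => hf.integrable.intervalIntegrable) (0 : ℝ) (f := f) (μ := volume)
  fun_prop

lemma vacancy_nonneg (hf : IsProbDensity f) {x y : ℝ} (hxy : x ≤ y) : 0 ≤ vacancy f x y := by
  rw [vacancy, intervalIntegral.integral_of_le hxy, sub_nonneg, ← hf.integral_eq_one]
  exact setIntegral_le_integral hf.integrable (ae_of_all _ hf.nonneg)

lemma vacancy_le_one (hf : IsProbDensity f) {x y : ℝ} (hxy : x ≤ y) : vacancy f x y ≤ 1 :=
  sub_le_self _ (intervalIntegral.integral_nonneg hxy fun t _ => hf.nonneg t)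

lemma withDensity_compl_Ioo (hf : IsProbDensity f) {x y : ℝ} (hxy : x ≤ y) :
    (volume : Measure ℝ).withDensity (fun x => ENNReal.ofReal (f x)) (Ioo x y)ᶜ =
      ENNReal.ofReal (vacancy f x y) := by
  have := hf.isProbabilityMeasure
  rw [prob_compl_eq_one_sub measurableSet_Ioo, withDensity_apply _ measurableSet_Ioo,
    ← ofReal_integral_eq_lintegral_ofReal hf.integrable.integrableOn (ae_of_all _ hf.nonneg),
    vacancy, ENNReal.ofReal_sub _ (intervalIntegral.integral_nonneg hxy fun t _ => hf.nonneg t),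
    intervalIntegral.integral_of_le hxy, integral_Ioc_eq_integral_Ioo, ENNReal.ofReal_one]

end vacancy

section expectation

variable {f : ℝ → ℝ} {n : ℕ} {i j : Fin n} {a b : ℝ}

lemma isProbabilityMeasure_sampleLaw (hf : IsProbDensity f) (n : ℕ) :
    IsProbabilityMeasure (sampleLaw f n) := by
  have := hf.isProbabilityMeasure
  unfold sampleLaw
  infer_instance

/-- The samples together with the pairs of points that they do not separate, where the samples `i`
and `j` are disregarded. -/
def sampleGapPairs (i j : Fin n) (a b : ℝ) : Set ((Fin n → ℝ) × (ℝ × ℝ)) :=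
  {z | z.2 ∈ orderedPairs a b ∧ ∀ k, k ≠ i → k ≠ j → z.1 k ∉ Ioo z.2.1 z.2.2}

lemma measurableSet_sampleGapPairs : MeasurableSet (sampleGapPairs i j a b) := by
  refine (measurable_snd (measurableSet_orderedPairs a b)).inter (measurableSet_setOfPred.2 ?_)
  refine Measurable.forall fun k => Measurable.imp measurable_const (Measurable.imp
    measurable_const (measurableSet_setOfPred.1 (MeasurableSet.compl ?_)))
  have hk : Measurable fun z : (Fin n → ℝ) × (ℝ × ℝ) => z.1 k :=
    (measurable_pi_apply k).comp measurable_fst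
  exact (measurableSet_lt (measurable_fst.comp measurable_snd) hk).inter
    (measurableSet_lt hk (measurable_snd.comp measurable_snd))

lemma leapfrogGiven_eq (hij : i ≠ j) (hab : a ≤ b) (x : Fin n → ℝ) :
    leapfrogGiven i j a b x =
      2 * (volume (Prod.mk x ⁻¹' sampleGapPairs i j a b)).toReal := by
  have hi : Function.update (Function.update x i a) j b i = a := by simp [hij]
  have hj : Function.update (Function.update x i a) j b j = b := by simp
  rw [leapfrogGiven, leapfrogDist_eq_volume_gapPairs _ _ _ (by rw [hi, hj]; exact hab), hi, hj]
  congr 3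
  ext q
  simp only [gapPairs, sampleGapPairs, mem_preimage, mem_ofPred_eq]
  refine and_congr_right fun hq => ⟨fun h k hki hkj => ?_, fun h k => ?_⟩
  · simpa [hki, hkj] using h k
  · obtain ⟨-, h2, h3⟩ := hq
    rw [uIcc_of_le hab] at h2 h3
    obtain rfl | hkj := eq_or_ne k j
    · rw [hj]
      exact fun h' => h'.2.not_ge h3.2
    obtain rfl | hki := eq_or_ne k i
    · rw [hi]
      exact fun h' => h'.1.not_ge h2.1
    simpa [hki, hkj] using h k hki hkj

lemma volume_sampleGapPairs_lt_top (x : Fin n → ℝ) :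
    volume (Prod.mk x ⁻¹' sampleGapPairs i j a b) < ∞ := by
  refine (measure_mono fun q hq => hq.1).trans_lt (?_ : volume (orderedPairs a b) < ∞)
  rw [volume_orderedPairs]
  exact ENNReal.ofReal_lt_top

lemma integrable_leapfrogGiven (hf : IsProbDensity f) (hij : i ≠ j) (hab : a ≤ b) :
    Integrable (leapfrogGiven i j a b) (sampleLaw f n) := by
  have := isProbabilityMeasure_sampleLaw hf n
  have hm : Measurable (leapfrogGiven i j a b) := by
    rw [funext (leapfrogGiven_eq hij hab)]
    exact (measurable_measure_prodMk_left measurableSet_sampleGapPairs).ennreal_toReal.const_mul 2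
  refine Integrable.of_bound hm.aestronglyMeasurable (2 * (volume (orderedPairs a b)).toReal)
    (ae_of_all _ fun x => ?_)
  rw [leapfrogGiven_eq hij hab, Real.norm_of_nonneg (by positivity)]
  gcongr
  · rw [volume_orderedPairs]
    exact ENNReal.ofReal_ne_top
  · exact fun q hq => hq.1

lemma sampleLaw_sampleGapPairs (hf : IsProbDensity f) (hij : i ≠ j) {q : ℝ × ℝ}
    (hq : q ∈ orderedPairs a b) :
    sampleLaw f n ((fun x => (x, q)) ⁻¹' sampleGapPairs i j a b) =
      ENNReal.ofReal (vacancy f q.1 q.2 ^ (n - 2)) := by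
  have := hf.isProbabilityMeasure
  have hset : (fun x => (x, q)) ⁻¹' sampleGapPairs i j a b =
      univ.pi fun k => if k ∈ ({i, j} : Finset (Fin n)) then univ else (Ioo q.1 q.2)ᶜ := by
    ext x
    simp only [sampleGapPairs, mem_preimage, mem_ofPred_eq, hq, true_and, mem_univ_pi,
      Finset.mem_insert, Finset.mem_singleton]
    refine forall_congr' fun k => ?_
    split_ifs with h
    · simp only [mem_univ, iff_true]
      tauto
    · rw [not_or] at h
      simp [h]
  rw [hset, sampleLaw, Measure.pi_pi]
  simp_rw [apply_ite, measure_univ, withDensity_compl_Ioo hf hq.1.le]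
  rw [Finset.prod_ite, Finset.prod_const_one, one_mul, Finset.prod_const,
    ENNReal.ofReal_pow (vacancy_nonneg hf hq.1.le), ← Finset.compl_filter, Finset.card_compl]
  simp [Finset.filter_or, Finset.filter_eq', Finset.card_pair hij]

lemma setIntegral_orderedPairs (hab : a ≤ b) {g : ℝ × ℝ → ℝ} (hg : Continuous g) :
    ∫ q in orderedPairs a b, g q = ∫ x in a..b, ∫ y in x..b, g (x, y) := by
  have hint : IntegrableOn g (orderedPairs a b) :=
    (hg.continuousOn.integrableOn_compact (isCompact_uIcc.prod isCompact_uIcc)).mono_set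
      fun q hq => ⟨hq.2.1, hq.2.2⟩
  have hsec : ∀ x, ∫ y, (orderedPairs a b).indicator g (x, y) =
      (Icc a b).indicator (fun x => ∫ y in x..b, g (x, y)) x := by
    intro x
    by_cases hx : x ∈ Icc a b
    · rw [indicator_of_mem hx, intervalIntegral.integral_of_le hx.2,
        ← integral_indicator measurableSet_Ioc]
      congr 1 with y
      have : (x, y) ∈ orderedPairs a b ↔ y ∈ Ioc x b := by
        simp only [orderedPairs, uIcc_of_le hab, mem_ofPred_eq, mem_Icc, mem_Ioc] at hx ⊢
        grind
      simp only [indicator, this]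
    · rw [indicator_of_notMem hx]
      have : ∀ y, (x, y) ∉ orderedPairs a b := fun y hy => by
        simp only [orderedPairs, uIcc_of_le hab, mem_ofPred_eq] at hy
        exact hx hy.2.1
      simp [indicator, this]
  rw [← integral_indicator (measurableSet_orderedPairs a b), Measure.volume_eq_prod,
    integral_prod _ (hint.integrable_indicator (measurableSet_orderedPairs a b))]
  simp_rw [hsec]
  rw [integral_indicator measurableSet_Icc, integral_Icc_eq_integral_Ioc,
    intervalIntegral.integral_of_le hab]

/-- By Tonelli's theorem, the expectation of the area is the integral over the pairs of the
probability that none of the `n - 2` free samples separates the pair. -/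
theorem expectedLeapfrog_eq (hf : IsProbDensity f) (hij : i ≠ j) (hab : a ≤ b) :
    expectedLeapfrog f n i j a b =
      2 * ∫ x in a..b, ∫ y in x..b, vacancy f x y ^ (n - 2) := by
  have := isProbabilityMeasure_sampleLaw hf n
  have hsec : ∀ q, sampleLaw f n ((fun x => (x, q)) ⁻¹' sampleGapPairs i j a b) =
      (orderedPairs a b).indicator (fun q => ENNReal.ofReal (vacancy f q.1 q.2 ^ (n - 2))) q := by
    intro q
    by_cases hq : q ∈ orderedPairs a b
    · rw [indicator_of_mem hq, sampleLaw_sampleGapPairs hf hij hq]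
    · rw [indicator_of_notMem hq]
      convert measure_empty (μ := sampleLaw f n)
      exact eq_empty_of_forall_notMem fun x hx => hq hx.1
  have hprod : ∫⁻ x, volume (Prod.mk x ⁻¹' sampleGapPairs i j a b) ∂(sampleLaw f n) =
      ∫⁻ q in orderedPairs a b, ENNReal.ofReal (vacancy f q.1 q.2 ^ (n - 2)) := by
    rw [← Measure.prod_apply measurableSet_sampleGapPairs,
      Measure.prod_apply_symm measurableSet_sampleGapPairs, ← lintegral_indicator
        (measurableSet_orderedPairs a b)]
    simp_rw [hsec]
  have hcont : Continuous fun q : ℝ × ℝ => vacancy f q.1 q.2 ^ (n - 2) :=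
    (continuous_vacancy hf).pow _
  rw [expectedLeapfrog, funext (leapfrogGiven_eq hij hab), integral_const_mul,
    integral_toReal (measurable_measure_prodMk_left measurableSet_sampleGapPairs).aemeasurable
      (ae_of_all _ volume_sampleGapPairs_lt_top), hprod,
    ← setIntegral_orderedPairs hab hcont, ← integral_eq_lintegral_of_nonneg_ae _
      hcont.aestronglyMeasurable]
  filter_upwards [ae_restrict_mem (measurableSet_orderedPairs a b)] with q hq
  exact pow_nonneg (vacancy_nonneg hf hq.1.le) _

end expectation

/-! ### Estimates on an interval of the superlevel set -/

section estimates

variable {f : ℝ → ℝ} {a b c : ℝ}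

lemma integral_exp_neg_mul_sub_le {k : ℝ} (hk : 0 < k) (a b : ℝ) :
    ∫ x in a..b, Real.exp (-(k * (b - x))) ≤ 1 / k := by
  have hd : ∀ x ∈ uIcc a b, HasDerivAt (fun x => Real.exp (-(k * (b - x))) / k)
      (Real.exp (-(k * (b - x)))) x := by
    intro x _
    have h := (((hasDerivAt_id x).const_sub b).const_mul k).neg.exp.div_const k
    refine h.congr_deriv ?_
    simp only [Pi.neg_apply, id]
    field_simp
  rw [intervalIntegral.integral_eq_sub_of_hasDerivAt hd
    (by apply Continuous.intervalIntegrable; fun_prop)]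
  simp only [sub_self, mul_zero, neg_zero, Real.exp_zero]
  exact sub_le_self _ (by positivity)

lemma integral_sub_mul_exp_neg_le {k : ℝ} (hk : 0 < k) (hab : a ≤ b) :
    ∫ y in a..b, (y - a) * Real.exp (-(k * (y - a))) ≤ 1 / k ^ 2 := by
  have hd : ∀ y ∈ uIcc a b, HasDerivAt
      (fun y => -(((y - a) / k + 1 / k ^ 2) * Real.exp (-(k * (y - a)))))
      ((y - a) * Real.exp (-(k * (y - a)))) y := by
    intro y _
    have h1 := ((hasDerivAt_id y).sub_const a)
    have h := (((h1.div_const k).add_const (1 / k ^ 2)).mul (h1.const_mul k).neg.exp).neg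
    refine h.congr_deriv ?_
    simp only [Pi.neg_apply, id]
    field_simp
    ring
  rw [intervalIntegral.integral_eq_sub_of_hasDerivAt hd
    (by apply Continuous.intervalIntegrable; fun_prop)]
  have : 0 ≤ ((b - a) / k + 1 / k ^ 2) * Real.exp (-(k * (b - a))) := by
    have := sub_nonneg.2 hab
    positivity
  simp only [sub_self, mul_zero, neg_zero, Real.exp_zero, zero_div, zero_add, mul_one]
  linarith

lemma vacancy_le_exp (hf : IsProbDensity f) {x y : ℝ} (hxy : x ≤ y)
    (hc : ∀ t ∈ Icc x y, c ≤ f t) : vacancy f x y ≤ Real.exp (-(c * (y - x))) := by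
  refine le_trans ?_ (Real.one_sub_le_exp_neg _)
  have h := intervalIntegral.integral_mono_on hxy intervalIntegrable_const
    (hf.integrable.intervalIntegrable (a := x) (b := y)) hc
  rw [intervalIntegral.integral_const, smul_eq_mul] at h
  rw [vacancy]
  linarith

lemma vacancy_pow_le_exp (hf : IsProbDensity f) {x y : ℝ} (hxy : x ≤ y)
    (hc : ∀ t ∈ Icc x y, c ≤ f t) (m : ℕ) :
    vacancy f x y ^ m ≤ Real.exp (-((m * c) * (y - x))) := by
  refine (pow_le_pow_left₀ (vacancy_nonneg hf hxy) (vacancy_le_exp hf hxy hc) m).trans_eq ?_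
  rw [← Real.exp_nat_mul]
  ring_nf

lemma continuous_integral_vacancy_pow (hf : IsProbDensity f) (b : ℝ) (m : ℕ) :
    Continuous fun x => ∫ y in x..b, vacancy f x y ^ m := by
  simp_rw [intervalIntegral.integral_symm b]
  exact (intervalIntegral.continuous_parametric_intervalIntegral_of_continuous
    (f := fun x y => vacancy f x y ^ m) ((continuous_vacancy hf).pow m) continuous_id).neg

/-- The vacancy decreases in its upper end at the rate `f`, by the fundamental theorem of
calculus. -/
lemma integral_mul_vacancy_pow (hf : IsProbDensity f) (hab : a ≤ b)
    (hcont : ContinuousOn f (Icc a b)) (m : ℕ) :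
    ∫ y in a..b, f y * vacancy f a y ^ m = (1 - vacancy f a b ^ (m + 1)) / (m + 1) := by
  have hva : Continuous fun y => vacancy f a y :=
    (continuous_vacancy hf).comp (continuous_const.prodMk continuous_id)
  have hm : (m + 1 : ℝ) ≠ 0 := by positivity
  have hd : ∀ y ∈ Ioo (min a b) (max a b), HasDerivWithinAt
      (fun y => -(vacancy f a y ^ (m + 1) / (m + 1))) (f y * vacancy f a y ^ m) (Ioi y) y := by
    intro y hy
    rw [min_eq_left hab, max_eq_right hab] at hy
    have h := intervalIntegral.integral_hasDerivAt_right
      (hf.integrable.intervalIntegrable (a := a) (b := y))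
      hf.measurable.stronglyMeasurable.stronglyMeasurableAtFilter
      (hcont.continuousAt (Icc_mem_nhds hy.1 hy.2))
    have h' := (((h.const_sub 1).pow (m + 1)).div_const (m + 1 : ℝ)).neg
    refine HasDerivAt.hasDerivWithinAt ?_
    refine h'.congr_deriv ?_
    simp only [vacancy, Nat.add_sub_cancel, Nat.cast_add, Nat.cast_one]
    field_simp
  have hcont' : ContinuousOn (fun y => f y * vacancy f a y ^ m) (uIcc a b) := by
    rw [uIcc_of_le hab]
    exact hcont.mul (hva.pow m).continuousOn
  rw [intervalIntegral.integral_eq_sub_of_hasDeriv_right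
    ((hva.pow (m + 1)).div_const _).neg.continuousOn hd hcont'.intervalIntegrable]
  simp [vacancy]
  ring

/-- Replacing `f y` by `f x` in `integral_mul_vacancy_pow` costs a term with the Lipschitz
constant, and the other term comes from the bounded range of integration. -/
lemma abs_integral_vacancy_pow_sub_le (hf : IsProbDensity f) (hc0 : 0 < c) (hab : a ≤ b)
    (hcont : ContinuousOn f (Icc a b)) (hc : ∀ t ∈ Icc a b, c ≤ f t) {L : ℝ} (hL0 : 0 ≤ L)
    (hL : ∀ y ∈ Icc a b, |f y - f a| ≤ L * (y - a)) {m : ℕ} (hm : 0 < m) :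
    |(∫ y in a..b, vacancy f a y ^ m) - 1 / ((m + 1) * f a)| ≤
      Real.exp (-((m * c) * (b - a))) / (m * c) + L / (m ^ 2 * c ^ 3) := by
  have hm' : (0 : ℝ) < m := by exact_mod_cast hm
  have hfa : c ≤ f a := hc a (left_mem_Icc.2 hab)
  have hfa0 : 0 < f a := hc0.trans_le hfa
  have hva : Continuous fun y => vacancy f a y :=
    (continuous_vacancy hf).comp (continuous_const.prodMk continuous_id)
  have h1 : IntervalIntegrable (fun y => f y * vacancy f a y ^ m) volume a b := by
    refine ContinuousOn.intervalIntegrable ?_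
    rw [uIcc_of_le hab]
    exact hcont.mul (hva.pow m).continuousOn
  have h2 : IntervalIntegrable (fun y => f a * vacancy f a y ^ m) volume a b :=
    (continuous_const.mul (hva.pow m)).intervalIntegrable a b
  -- the Lipschitz error
  have h3 : |∫ y in a..b, (f y - f a) * vacancy f a y ^ m| ≤ L / (m * c) ^ 2 := by
    rw [← Real.norm_eq_abs]
    refine (intervalIntegral.norm_integral_le_of_norm_le hab
      (g := fun y => L * ((y - a) * Real.exp (-((m * c) * (y - a)))))
      (ae_of_all _ fun y hy => ?_) (by apply Continuous.intervalIntegrable; fun_prop)).trans ?_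
    · rw [norm_mul, Real.norm_eq_abs, Real.norm_of_nonneg (pow_nonneg
        (vacancy_nonneg hf hy.1.le) _), ← mul_assoc]
      exact mul_le_mul (hL y ⟨hy.1.le, hy.2⟩) (vacancy_pow_le_exp hf hy.1.le
        (fun t ht => hc t ⟨ht.1, ht.2.trans hy.2⟩) m) (pow_nonneg (vacancy_nonneg hf hy.1.le) _)
        (mul_nonneg hL0 (sub_nonneg.2 hy.1.le))
    · rw [intervalIntegral.integral_const_mul, div_eq_mul_one_div]
      exact mul_le_mul_of_nonneg_left (integral_sub_mul_exp_neg_le (by positivity) hab) hL0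
  -- the error from the upper end of the range
  have h4 : vacancy f a b ^ (m + 1) / (m + 1) ≤ Real.exp (-((m * c) * (b - a))) / m := by
    have h0 := vacancy_nonneg hf hab
    refine div_le_div₀ (by positivity) ?_ hm' (by linarith)
    exact (pow_le_pow_of_le_one h0 (vacancy_le_one hf hab) m.le_succ).trans
      (vacancy_pow_le_exp hf hab hc m)
  have h4' : 0 ≤ vacancy f a b ^ (m + 1) / (m + 1) := by
    have h0 := vacancy_nonneg hf hab
    positivity
  have h5 : f a * ((∫ y in a..b, vacancy f a y ^ m) - 1 / ((m + 1) * f a)) =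
      -(vacancy f a b ^ (m + 1) / (m + 1)) - ∫ y in a..b, (f y - f a) * vacancy f a y ^ m := by
    simp_rw [sub_mul]
    rw [intervalIntegral.integral_sub h1 h2, integral_mul_vacancy_pow hf hab hcont,
      intervalIntegral.integral_const_mul]
    field_simp
    ring
  have h6 : c * |(∫ y in a..b, vacancy f a y ^ m) - 1 / ((m + 1) * f a)| ≤
      Real.exp (-((m * c) * (b - a))) / m + L / (m * c) ^ 2 := by
    calc _ ≤ f a * |(∫ y in a..b, vacancy f a y ^ m) - 1 / ((m + 1) * f a)| := by gcongr
      _ = |f a * ((∫ y in a..b, vacancy f a y ^ m) - 1 / ((m + 1) * f a))| := by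
        rw [abs_mul, abs_of_pos hfa0]
      _ ≤ _ := by
        rw [h5]
        refine (abs_sub _ _).trans (add_le_add ?_ h3)
        rwa [abs_neg, abs_of_nonneg h4']
  rw [← mul_le_mul_iff_right₀ hc0]
  refine h6.trans_eq ?_
  field_simp

lemma intervalIntegrable_one_div (hc0 : 0 < c) (hab : a ≤ b) (hcont : ContinuousOn f (Icc a b))
    (hc : ∀ t ∈ Icc a b, c ≤ f t) : IntervalIntegrable (fun x => 1 / f x) volume a b := by
  refine ContinuousOn.intervalIntegrable ?_
  rw [uIcc_of_le hab]
  exact continuousOn_const.div hcont fun t ht => (hc0.trans_le (hc t ht)).ne'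

lemma integral_one_div_nonneg_and_le (hc0 : 0 < c) (hab : a ≤ b)
    (hcont : ContinuousOn f (Icc a b)) (hc : ∀ t ∈ Icc a b, c ≤ f t) :
    0 ≤ ∫ x in a..b, 1 / f x ∧ ∫ x in a..b, 1 / f x ≤ (b - a) / c := by
  refine ⟨intervalIntegral.integral_nonneg hab fun t ht =>
    one_div_nonneg.2 (hc0.le.trans (hc t ht)), ?_⟩
  refine (intervalIntegral.integral_mono_on hab (intervalIntegrable_one_div hc0 hab hcont hc)
    (intervalIntegrable_const (c := 1 / c)) fun t ht => ?_).trans_eq ?_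
  · exact one_div_le_one_div_of_le hc0 (hc t ht)
  · simp [div_eq_mul_inv]

/-- The remainder is `O(1/n²)` if the density is Lipschitz. -/
lemma abs_integral_integral_vacancy_pow_sub_le (hf : IsProbDensity f) (hc0 : 0 < c) (hab : a ≤ b)
    (hc : ∀ t ∈ Icc a b, c ≤ f t) {L : ℝ≥0} (hL : LipschitzOnWith L f (Icc a b))
    {m : ℕ} (hm : 0 < m) :
    |(∫ x in a..b, ∫ y in x..b, vacancy f x y ^ m) - 1 / (m + 1) * ∫ x in a..b, 1 / f x| ≤
      (1 / c ^ 2 + (b - a) * (L / c ^ 3)) / m ^ 2 := by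
  have hm' : (0 : ℝ) < m := by exact_mod_cast hm
  rw [← intervalIntegral.integral_const_mul, ← intervalIntegral.integral_sub
    ((continuous_integral_vacancy_pow hf b m).intervalIntegrable a b)
    ((intervalIntegrable_one_div hc0 hab hL.continuousOn hc).const_mul _), ← Real.norm_eq_abs]
  refine (intervalIntegral.norm_integral_le_of_norm_le hab (g := fun x =>
    Real.exp (-((m * c) * (b - x))) / (m * c) + L / (m ^ 2 * c ^ 3))
    (ae_of_all _ fun x hx => ?_) (by apply Continuous.intervalIntegrable; fun_prop)).trans ?_
  · have hsub : Icc x b ⊆ Icc a b := Icc_subset_Icc_left hx.1.le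
    rw [Real.norm_eq_abs, one_div_mul_one_div]
    refine abs_integral_vacancy_pow_sub_le hf hc0 hx.2 (hL.continuousOn.mono hsub)
      (fun t ht => hc t (hsub ht)) L.2 (fun y hy => ?_) hm
    have := hL.dist_le_mul y (hsub hy) x (hsub (left_mem_Icc.2 hx.2))
    rwa [Real.dist_eq, Real.dist_eq, abs_of_nonneg (sub_nonneg.2 hy.1)] at this
  · rw [intervalIntegral.integral_add (by apply Continuous.intervalIntegrable; fun_prop)
      (by apply Continuous.intervalIntegrable; fun_prop), intervalIntegral.integral_div,
      intervalIntegral.integral_const, smul_eq_mul]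
    have h := div_le_div_of_nonneg_right
      (integral_exp_neg_mul_sub_le (k := m * c) (by positivity) a b) (by positivity : 0 ≤ m * c)
    refine (add_le_add_left h _).trans_eq ?_
    field_simp

/-- Continuous induction along the interval. -/
lemma LocallyLipschitzOnWith.lipschitzOnWith_Icc {L : ℝ≥0} {s : Set ℝ}
    (h : LocallyLipschitzOnWith L f s) (hs : Icc a b ⊆ s) : LipschitzOnWith L f (Icc a b) := by
  have hcont : ContinuousOn f (Icc a b) := fun x hx => by
    obtain ⟨t, ht, hLt⟩ := h x (hs hx)
    exact ((hLt.continuousOn x (mem_of_mem_nhdsWithin (hs hx) ht)).mono_of_mem_nhdsWithin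
      ht).mono hs
  refine LipschitzOnWith.of_dist_le_mul fun x hx y hy => ?_
  wlog hxy : x ≤ y generalizing x y
  · rw [dist_comm, dist_comm x]
    exact this y hy x hx (le_of_not_ge hxy)
  have hsub : Icc x y ⊆ Icc a b := Icc_subset_Icc hx.1 hy.2
  have hclosed : IsClosed ({z | dist (f x) (f z) ≤ L * dist x z} ∩ Icc x y) := by
    rw [inter_comm]
    exact isClosed_Icc.isClosed_le ((continuous_const.dist continuous_id).comp_continuousOn
      (hcont.mono hsub))
      (continuous_const.mul (continuous_const.dist continuous_id)).continuousOn
  refine hclosed.Icc_subset_of_forall_mem_nhdsWithin ?_ ?_ (right_mem_Icc.2 hxy)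
  · simp
  · rintro z ⟨hz, hzx, hzy⟩
    obtain ⟨t, ht, hLt⟩ := h z (hs (hsub ⟨hzx, hzy.le⟩))
    have ht' : t ∈ 𝓝[>] z := by
      rw [← nhdsWithin_Ioc_eq_nhdsGT hzy]
      exact nhdsWithin_mono _ (fun w hw => hs (hsub ⟨hzx.trans hw.1.le, hw.2⟩)) ht
    filter_upwards [ht', self_mem_nhdsWithin] with w hw hzw
    have h1 := hLt.dist_le_mul z (mem_of_mem_nhdsWithin (hs (hsub ⟨hzx, hzy.le⟩)) ht) w hw
    refine (dist_triangle _ (f z) _).trans ((add_le_add hz h1).trans_eq ?_)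
    rw [← mul_add, dist_comm x z, dist_comm z w, dist_comm x w, Real.dist_eq, Real.dist_eq,
      Real.dist_eq, abs_of_nonneg (sub_nonneg.2 hzx), abs_of_nonneg (sub_nonneg.2 (le_of_lt hzw)),
      abs_of_nonneg (sub_nonneg.2 (hzx.trans (le_of_lt hzw)))]
    ring

end estimates

/-! ### The limit of the rescaled gap integrals -/

section limit

variable {f : ℝ → ℝ} {a b c : ℝ}

/-- The integral of `vacancy f x y ^ m` over all `y > x`, in the variable `u = m * (y - x)`. The
vacancy is capped by its bound on the intervals on which `f ≥ c`, so that the integral is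
dominated at every `x` and does not depend on how far such an interval extends. -/
noncomputable def scaledGap (f : ℝ → ℝ) (c : ℝ) (m : ℕ) (x : ℝ) : ℝ :=
  ∫ u in Ioi (0 : ℝ), min (vacancy f x (x + u / m)) (Real.exp (-(c * (u / m)))) ^ m

lemma continuous_capped_vacancy (hf : IsProbDensity f) (c : ℝ) (m : ℕ) :
    Continuous fun q : ℝ × ℝ =>
      min (vacancy f q.1 (q.1 + q.2 / m)) (Real.exp (-(c * (q.2 / m)))) ^ m := by
  have h : Continuous fun q : ℝ × ℝ => vacancy f q.1 (q.1 + q.2 / m) :=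
    (continuous_vacancy hf).comp (by fun_prop : Continuous fun q : ℝ × ℝ => (q.1, q.1 + q.2 / m))
  fun_prop

lemma stronglyMeasurable_scaledGap (hf : IsProbDensity f) (c : ℝ) (m : ℕ) :
    StronglyMeasurable (scaledGap f c m) :=
  (continuous_capped_vacancy hf c m).stronglyMeasurable.integral_prod_right'

lemma capped_vacancy_mem_Icc (hf : IsProbDensity f) (c : ℝ) {m : ℕ} (hm : 0 < m) (x : ℝ) {u : ℝ}
    (hu : 0 ≤ u) :
    min (vacancy f x (x + u / m)) (Real.exp (-(c * (u / m)))) ^ m ∈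
      Icc 0 (Real.exp (-c * u)) := by
  have hm' : (0 : ℝ) < m := by exact_mod_cast hm
  have h0 : 0 ≤ min (vacancy f x (x + u / m)) (Real.exp (-(c * (u / m)))) :=
    le_min (vacancy_nonneg hf (by linarith [div_nonneg hu hm'.le])) (Real.exp_pos _).le
  refine ⟨pow_nonneg h0 _, (pow_le_pow_left₀ h0 (min_le_right _ _) m).trans_eq ?_⟩
  rw [← Real.exp_nat_mul]
  congr 1
  field_simp

lemma integrableOn_capped_vacancy (hf : IsProbDensity f) (hc0 : 0 < c) {m : ℕ} (hm : 0 < m)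
    (x : ℝ) {T : ℝ} (hT : 0 ≤ T) :
    IntegrableOn (fun u => min (vacancy f x (x + u / m)) (Real.exp (-(c * (u / m)))) ^ m)
      (Ioi T) := by
  refine Integrable.mono' (integrableOn_exp_mul_Ioi (neg_neg_of_pos hc0) T)
    ((continuous_capped_vacancy hf c m).comp
      (continuous_const.prodMk continuous_id)).aestronglyMeasurable ?_
  filter_upwards [ae_restrict_mem measurableSet_Ioi] with u hu
  have h := capped_vacancy_mem_Icc hf c hm x (hT.trans (le_of_lt hu))
  rw [Real.norm_of_nonneg h.1]
  exact h.2

lemma setIntegral_capped_vacancy_mem_Icc (hf : IsProbDensity f) (hc0 : 0 < c) {m : ℕ} (hm : 0 < m)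
    (x : ℝ) {T : ℝ} (hT : 0 ≤ T) :
    ∫ u in Ioi T, min (vacancy f x (x + u / m)) (Real.exp (-(c * (u / m)))) ^ m ∈
      Icc 0 (Real.exp (-c * T) / c) := by
  have h : ∀ u ∈ Ioi T, _ := fun u hu =>
    capped_vacancy_mem_Icc hf c hm x (hT.trans (le_of_lt hu))
  refine ⟨setIntegral_nonneg measurableSet_Ioi fun u hu => (h u hu).1, ?_⟩
  refine (setIntegral_mono_on (integrableOn_capped_vacancy hf hc0 hm x hT)
    (integrableOn_exp_mul_Ioi (neg_neg_of_pos hc0) T) measurableSet_Ioi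
      fun u hu => (h u hu).2).trans_eq ?_
  rw [integral_exp_mul_Ioi (neg_neg_of_pos hc0), neg_div_neg_eq]

lemma scaledGap_mem_Icc (hf : IsProbDensity f) (hc0 : 0 < c) {m : ℕ} (hm : 0 < m) (x : ℝ) :
    scaledGap f c m x ∈ Icc 0 (1 / c) := by
  simpa [scaledGap] using setIntegral_capped_vacancy_mem_Icc hf hc0 hm x le_rfl

lemma abs_scaledGap_sub_le (hf : IsProbDensity f) (hc0 : 0 < c) (hab : a ≤ b)
    (hc : ∀ t ∈ Icc a b, c ≤ f t) {m : ℕ} (hm : 0 < m) :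
    |m * (∫ y in a..b, vacancy f a y ^ m) - scaledGap f c m a| ≤
      Real.exp (-((m * c) * (b - a))) / c := by
  have hm' : (0 : ℝ) < m := by exact_mod_cast hm
  have hT : 0 ≤ m * (b - a) := mul_nonneg hm'.le (sub_nonneg.2 hab)
  have h1 : m * (∫ y in a..b, vacancy f a y ^ m) = ∫ u in (0 : ℝ)..m * (b - a),
      min (vacancy f a (a + u / m)) (Real.exp (-(c * (u / m)))) ^ m := by
    have h := intervalIntegral.integral_comp_add_div (a := 0) (b := m * (b - a))
      (fun y => vacancy f a y ^ m) hm'.ne' a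
    rw [zero_div, add_zero, mul_div_cancel_left₀ _ hm'.ne', add_sub_cancel, smul_eq_mul] at h
    rw [← h]
    refine intervalIntegral.integral_congr fun u hu => ?_
    rw [uIcc_of_le hT] at hu
    have hu0 : 0 ≤ u / m := div_nonneg hu.1 hm'.le
    have hub : u / m ≤ b - a := by
      rw [div_le_iff₀' hm']
      exact hu.2
    have h' := vacancy_le_exp hf (c := c) (x := a) (y := a + u / m) (by linarith)
      fun t ht => hc t ⟨ht.1, by linarith [ht.2]⟩
    rw [add_sub_cancel_left] at h'
    simp only [min_eq_left h']
  have h2 := intervalIntegral.integral_interval_add_Ioi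
    (integrableOn_capped_vacancy hf hc0 hm a le_rfl) (integrableOn_capped_vacancy hf hc0 hm a hT)
  have h3 := setIntegral_capped_vacancy_mem_Icc hf hc0 hm a hT
  rw [h1, abs_sub_comm, scaledGap, ← h2, add_sub_cancel_left, abs_of_nonneg h3.1]
  refine h3.2.trans_eq ?_
  ring_nf

/-- At a Lebesgue point, the probability that an interval of length `u / m` is missed by `m`
samples tends to `exp (- f x * u)`. -/
lemma tendsto_capped_vacancy (hf : IsProbDensity f) {x : ℝ} (hx : c ≤ f x)
    (hd : HasDerivAt (fun y => ∫ t in x..y, f t) (f x) x) {u : ℝ} (hu : 0 ≤ u) :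
    Tendsto (fun m : ℕ => min (vacancy f x (x + u / m)) (Real.exp (-(c * (u / m)))) ^ m) atTop
      (𝓝 (Real.exp (-f x * u))) := by
  have h1 : Tendsto (fun m : ℕ => vacancy f x (x + u / m) ^ m) atTop
      (𝓝 (Real.exp (-f x * u))) := by
    have h := hd.hasFDerivAt.lim u (c := fun m : ℕ => (m : ℝ)) (l := atTop)
      (by simpa using tendsto_natCast_atTop_atTop)
    have h' := Real.tendsto_one_add_pow_exp_of_tendsto
      (g := fun m : ℕ => -∫ t in x..(x + u / m), f t) (t := -f x * u) (by
        convert h.neg using 2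
        · simp [div_eq_inv_mul]
        · simp [mul_comm])
    simpa only [vacancy, ← sub_eq_add_neg] using h'
  have h2 : Tendsto (fun m : ℕ => Real.exp (-(c * (u / m))) ^ m) atTop
      (𝓝 (Real.exp (-c * u))) := by
    refine tendsto_const_nhds.congr' ?_
    filter_upwards [eventually_gt_atTop 0] with m hm
    have hm' : (m : ℝ) ≠ 0 := by positivity
    rw [← Real.exp_nat_mul]
    congr 1
    field_simp
  have h3 := h1.min h2
  rw [min_eq_left (Real.exp_le_exp.2 (by nlinarith))] at h3
  refine h3.congr fun m => ?_
  have hv : 0 ≤ vacancy f x (x + u / m) :=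
    vacancy_nonneg hf (by linarith [div_nonneg hu m.cast_nonneg])
  obtain h | h := le_total (vacancy f x (x + u / m)) (Real.exp (-(c * (u / m))))
  · rw [min_eq_left h, min_eq_left (pow_le_pow_left₀ hv h m)]
  · rw [min_eq_right h, min_eq_right (pow_le_pow_left₀ (Real.exp_pos _).le h m)]

lemma tendsto_scaledGap (hf : IsProbDensity f) (hc0 : 0 < c) {x : ℝ} (hx : c ≤ f x)
    (hd : HasDerivAt (fun y => ∫ t in x..y, f t) (f x) x) :
    Tendsto (fun m => scaledGap f c m x) atTop (𝓝 (1 / f x)) := by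
  have hlim : ∫ u in Ioi (0 : ℝ), Real.exp (-f x * u) = 1 / f x := by
    rw [integral_exp_mul_Ioi (neg_neg_of_pos (hc0.trans_le hx)), neg_div_neg_eq, mul_zero,
      Real.exp_zero]
  rw [← hlim]
  refine tendsto_integral_filter_of_dominated_convergence (fun u => Real.exp (-c * u))
    (Eventually.of_forall fun m => ?_) ?_ (integrableOn_exp_mul_Ioi (neg_neg_of_pos hc0) 0) ?_
  · exact ((continuous_capped_vacancy hf c m).comp
      (continuous_const.prodMk continuous_id)).aestronglyMeasurable
  · filter_upwards [eventually_gt_atTop 0] with m hm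
    filter_upwards [ae_restrict_mem measurableSet_Ioi] with u hu
    have h := capped_vacancy_mem_Icc hf c hm x (le_of_lt hu)
    rw [Real.norm_of_nonneg h.1]
    exact h.2
  · filter_upwards [ae_restrict_mem measurableSet_Ioi] with u hu
    exact tendsto_capped_vacancy hf hx hd (le_of_lt hu)

lemma measurableSet_superlevel (hf : IsProbDensity f) (c : ℝ) :
    MeasurableSet (superlevel f c) :=
  measurableSet_le measurable_const hf.measurable

lemma volume_superlevel_lt_top (hf : IsProbDensity f) (hc0 : 0 < c) :
    volume (superlevel f c) < ∞ := by
  have h := meas_ge_le_lintegral_div (μ := volume) hf.measurable.ennreal_ofReal.aemeasurable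
    (ENNReal.ofReal_pos.2 hc0).ne' ENNReal.ofReal_ne_top
  rw [hf.lintegral_eq_one] at h
  refine (measure_mono fun x hx => ?_).trans_lt (h.trans_lt ?_)
  · exact ENNReal.ofReal_le_ofReal hx
  · exact ENNReal.div_lt_top ENNReal.one_ne_top (ENNReal.ofReal_pos.2 hc0).ne'

lemma abs_scaledGap_sub_one_div_le (hf : IsProbDensity f) (hc0 : 0 < c) {m : ℕ} (hm : 0 < m)
    {x : ℝ} (hx : c ≤ f x) : |scaledGap f c m x - 1 / f x| ≤ 1 / c := by
  have h := scaledGap_mem_Icc hf hc0 hm x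
  have h1 : 1 / f x ≤ 1 / c := one_div_le_one_div_of_le hc0 hx
  have h2 : 0 ≤ 1 / f x := one_div_nonneg.2 (hc0.le.trans hx)
  rw [abs_le]
  constructor <;> linarith [h.1, h.2]

lemma integrableOn_abs_scaledGap_sub (hf : IsProbDensity f) (hc0 : 0 < c) {m : ℕ} (hm : 0 < m) :
    IntegrableOn (fun x => |scaledGap f c m x - 1 / f x|) (superlevel f c) := by
  refine Measure.integrableOn_of_bounded (M := 1 / c) (volume_superlevel_lt_top hf hc0).ne
    ((stronglyMeasurable_scaledGap hf c m).measurable.sub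
      (hf.measurable.const_div 1)).abs.aestronglyMeasurable ?_
  filter_upwards [ae_restrict_mem (measurableSet_superlevel hf c)] with x hx
  rw [Real.norm_eq_abs, abs_abs]
  exact abs_scaledGap_sub_one_div_le hf hc0 hm hx

/-- By Lebesgue's differentiation theorem and dominated convergence. -/
lemma tendsto_setIntegral_abs_scaledGap_sub (hf : IsProbDensity f) (hc0 : 0 < c) :
    Tendsto (fun m => ∫ x in superlevel f c, |scaledGap f c m x - 1 / f x|) atTop (𝓝 0) := by
  rw [← integral_zero ℝ ℝ (μ := volume.restrict (superlevel f c))]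
  refine tendsto_integral_filter_of_dominated_convergence (fun _ => 1 / c)
    (Eventually.of_forall fun m => ?_) ?_ (integrableOn_const (volume_superlevel_lt_top hf hc0).ne)
    ?_
  · exact ((stronglyMeasurable_scaledGap hf c m).measurable.sub
      (hf.measurable.const_div 1)).abs.aestronglyMeasurable
  · filter_upwards [eventually_gt_atTop 0] with m hm
    filter_upwards [ae_restrict_mem (measurableSet_superlevel hf c)] with x hx
    rw [Real.norm_eq_abs, abs_abs]
    exact abs_scaledGap_sub_one_div_le hf hc0 hm hx
  · filter_upwards [ae_restrict_mem (measurableSet_superlevel hf c),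
      ae_restrict_of_ae (LocallyIntegrable.ae_hasDerivAt_integral
        hf.integrable.locallyIntegrable)] with x hx hd
    simpa using ((tendsto_scaledGap hf hc0 hx (hd x)).sub_const (1 / f x)).abs

lemma abs_mul_integral_integral_sub_le (hf : IsProbDensity f) (hc0 : 0 < c) (hab : a ≤ b)
    (hcont : ContinuousOn f (Icc a b)) (hc : Icc a b ⊆ superlevel f c) {m : ℕ} (hm : 0 < m) :
    |m * (∫ x in a..b, ∫ y in x..b, vacancy f x y ^ m) - ∫ x in a..b, 1 / f x| ≤
      (∫ x in superlevel f c, |scaledGap f c m x - 1 / f x|) + 1 / (m * c ^ 2) := by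
  have hm' : (0 : ℝ) < m := by exact_mod_cast hm
  have hsub : Ioc a b ⊆ superlevel f c := Ioc_subset_Icc_self.trans hc
  have hint : IntervalIntegrable (fun x => |scaledGap f c m x - 1 / f x|) volume a b :=
    (intervalIntegrable_iff_integrableOn_Ioc_of_le hab).2
      ((integrableOn_abs_scaledGap_sub hf hc0 hm).mono_set hsub)
  have hexp : IntervalIntegrable (fun x => Real.exp (-((m * c) * (b - x))) / c) volume a b := by
    apply Continuous.intervalIntegrable
    fun_prop
  rw [← intervalIntegral.integral_const_mul, ← intervalIntegral.integral_sub
    (((continuous_integral_vacancy_pow hf b m).const_mul _).intervalIntegrable a b)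
    (intervalIntegrable_one_div hc0 hab hcont hc), ← Real.norm_eq_abs]
  refine (intervalIntegral.norm_integral_le_of_norm_le hab (g := fun x =>
    |scaledGap f c m x - 1 / f x| + Real.exp (-((m * c) * (b - x))) / c)
    (ae_of_all _ fun x hx => ?_) (hint.add hexp)).trans ?_
  · have h := abs_scaledGap_sub_le hf hc0 hx.2
      (fun t ht => hc ⟨hx.1.le.trans ht.1, ht.2⟩) hm
    rw [Real.norm_eq_abs, add_comm]
    exact (abs_sub_le _ _ _).trans (add_le_add_left h _)
  · rw [intervalIntegral.integral_add hint hexp, intervalIntegral.integral_of_le hab,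
      intervalIntegral.integral_div]
    refine add_le_add (setIntegral_mono_set (integrableOn_abs_scaledGap_sub hf hc0 hm)
      (ae_of_all _ fun x => abs_nonneg _) hsub.eventuallyLE) ?_
    refine (div_le_div_of_nonneg_right (integral_exp_neg_mul_sub_le (k := m * c) (by positivity)
      a b) hc0.le).trans_eq ?_
    field_simp

end limit

/-! ### Uniform bounds on the remainder -/

section remainder

variable {f : ℝ → ℝ} {a b c : ℝ}

lemma sub_le_volume_superlevel (hf : IsProbDensity f) (hc0 : 0 < c) (hab : a ≤ b)
    (hc : Icc a b ⊆ superlevel f c) : b - a ≤ (volume (superlevel f c)).toReal := by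
  have h := ENNReal.toReal_mono (volume_superlevel_lt_top hf hc0).ne (measure_mono hc)
  rwa [Real.volume_Icc, ENNReal.toReal_ofReal (sub_nonneg.2 hab)] at h

lemma continuousOn_of_subset_superlevel (hcont : ContinuousOn f (Function.support f))
    (hc0 : 0 < c) (hc : Icc a b ⊆ superlevel f c) : ContinuousOn f (Icc a b) :=
  hcont.mono fun _ hx => (hc0.trans_le (hc hx)).ne'

theorem expectedLeapfrog_sub_isLittleO (hf : IsProbDensity f)
    (hcont : ContinuousOn f (Function.support f)) (hc0 : 0 < c) {ε : ℝ} (hε : 0 < ε) :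
    ∃ n₀ : ℕ, ∀ n : ℕ, n₀ ≤ n → ∀ i j : Fin n, i ≠ j →
      ∀ a b : ℝ, a < b → Icc a b ⊆ superlevel f c →
        |expectedLeapfrog f n i j a b - 2 / (n : ℝ) * ∫ x in a..b, 1 / f x| ≤
          ε * (1 / (n : ℝ)) := by
  set V := (volume (superlevel f c)).toReal with hV
  have hlim : Tendsto (fun m : ℕ => 6 * ((∫ x in superlevel f c, |scaledGap f c m x - 1 / f x|) +
      1 / c ^ 2 * (m : ℝ)⁻¹) + 4 * (V / c) * (m : ℝ)⁻¹) atTop (𝓝 0) := by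
    have h := tendsto_inv_atTop_nhds_zero_nat (𝕜 := ℝ)
    simpa only [mul_zero, add_zero] using (((tendsto_setIntegral_abs_scaledGap_sub hf hc0).add
      (h.const_mul (1 / c ^ 2))).const_mul 6).add (h.const_mul (4 * (V / c)))
  obtain ⟨m₀, hm₀⟩ := eventually_atTop.1 (hlim.eventually_le_const hε)
  refine ⟨m₀ + 3, fun n hn i j hij a b hab hsub => ?_⟩
  obtain ⟨m, rfl⟩ : ∃ m, n = m + 2 := ⟨n - 2, by omega⟩
  have hm : 0 < m := by omega
  have hm1 : (1 : ℝ) ≤ m := by exact_mod_cast hm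
  have hcont' := continuousOn_of_subset_superlevel hcont hc0 hsub
  rw [expectedLeapfrog_eq hf hij hab.le, Nat.add_sub_cancel]
  have h1 := abs_mul_integral_integral_sub_le hf hc0 hab.le hcont' hsub hm
  obtain ⟨hQ0, hQ⟩ := integral_one_div_nonneg_and_le hc0 hab.le hcont' hsub
  have hQV := hQ.trans
    (div_le_div_of_nonneg_right (sub_le_volume_superlevel hf hc0 hab.le hsub) hc0.le)
  have h2 := hm₀ m (by omega)
  set D := ∫ x in a..b, ∫ y in x..b, vacancy f x y ^ m
  set Q := ∫ x in a..b, 1 / f x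
  set δ := ∫ x in superlevel f c, |scaledGap f c m x - 1 / f x|
  rw [← hV] at hQV
  push_cast
  have hkey : 2 * D - 2 / ((m : ℝ) + 2) * Q =
      (2 * ((m + 2) / m) * (m * D - Q) + 4 * Q * (m : ℝ)⁻¹) * (1 / ((m : ℝ) + 2)) := by
    field_simp
    ring
  rw [hkey, abs_mul, abs_of_nonneg (by positivity : 0 ≤ 1 / ((m : ℝ) + 2))]
  gcongr
  refine le_trans ?_ h2
  refine (abs_add_le _ _).trans (add_le_add ?_ ?_)
  · rw [abs_mul, abs_of_nonneg (by positivity)]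
    refine mul_le_mul ?_ (h1.trans_eq ?_) (abs_nonneg _) (by norm_num)
    · rw [mul_div_assoc', div_le_iff₀ (by positivity)]
      linarith
    · field_simp
  · rw [abs_of_nonneg (by positivity)]
    gcongr

theorem expectedLeapfrog_sub_le_of_lipschitz (hf : IsProbDensity f) (hc0 : 0 < c) {L : ℝ≥0}
    (hL : LocallyLipschitzOnWith L f (superlevel f c)) :
    ∃ n₀ : ℕ, ∀ n : ℕ, n₀ ≤ n → ∀ i j : Fin n, i ≠ j →
      ∀ a b : ℝ, a < b → Icc a b ⊆ superlevel f c →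
        |expectedLeapfrog f n i j a b - 2 / (n : ℝ) * ∫ x in a..b, 1 / f x| ≤
          10 * (n : ℝ) ^ (-(3 / 2) : ℝ) * (volume (superlevel f c)).toReal ^ 2 := by
  set V := (volume (superlevel f c)).toReal with hV
  set C := 18 * (1 / c ^ 2 + V * (L / c ^ 3) + V / c) with hC
  refine ⟨3 + ⌈(C / (10 * V ^ 2)) ^ 2⌉₊, fun n hn i j hij a b hab hsub => ?_⟩
  obtain ⟨m, rfl⟩ : ∃ m, n = m + 2 := ⟨n - 2, by omega⟩
  have hm : 0 < m := by omega
  have hm1 : (1 : ℝ) ≤ m := by exact_mod_cast hm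
  have hLip := hL.lipschitzOnWith_Icc hsub
  have hbaV : b - a ≤ V := sub_le_volume_superlevel hf hc0 hab.le hsub
  have hV0 : 0 < V := (sub_pos.2 hab).trans_le hbaV
  have h1 := abs_integral_integral_vacancy_pow_sub_le hf hc0 hab.le hsub hLip hm
  obtain ⟨hQ0, hQ⟩ := integral_one_div_nonneg_and_le hc0 hab.le hLip.continuousOn hsub
  have hQV := hQ.trans (div_le_div_of_nonneg_right hbaV hc0.le)
  rw [expectedLeapfrog_eq hf hij hab.le, Nat.add_sub_cancel]
  set D := ∫ x in a..b, ∫ y in x..b, vacancy f x y ^ m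
  set Q := ∫ x in a..b, 1 / f x
  have hC0 : 0 ≤ C := by positivity
  have h2 : |2 * D - 2 / ((m + 2 : ℕ) : ℝ) * Q| ≤ C / ((m + 2 : ℕ) : ℝ) ^ 2 := by
    push_cast
    have hkey : 2 * D - 2 / ((m : ℝ) + 2) * Q =
        2 * (D - 1 / (m + 1) * Q) + 2 * (Q / ((m + 1) * (m + 2))) := by
      field_simp
      ring
    rw [hkey]
    calc _ ≤ 2 * ((1 / c ^ 2 + V * (L / c ^ 3)) / m ^ 2) + 2 * (V / c / m ^ 2) := by
          refine (abs_add_le _ _).trans (add_le_add ?_ ?_)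
          · rw [abs_mul, abs_two]
            refine mul_le_mul_of_nonneg_left (h1.trans ?_) two_pos.le
            gcongr
          · rw [abs_of_nonneg (by positivity)]
            gcongr
            nlinarith
      _ = C / (3 * m) ^ 2 := by
          rw [hC]
          field_simp
          ring
      _ ≤ C / ((m : ℝ) + 2) ^ 2 := by
          gcongr
          linarith
  refine h2.trans ?_
  -- `n₀` is chosen such that `C ≤ 10 * V ^ 2 * √n`
  set N : ℝ := ((m + 2 : ℕ) : ℝ) with hN
  have hN0 : 0 < N := by positivity
  have hsqrt : C / (10 * V ^ 2) ≤ N ^ (1 / 2 : ℝ) := by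
    rw [← Real.sqrt_eq_rpow]
    refine Real.le_sqrt_of_sq_le ((Nat.le_ceil _).trans ?_)
    exact Nat.cast_le.2 (by omega)
  have hpow : N ^ (-(3 / 2) : ℝ) = N ^ (1 / 2 : ℝ) / N ^ 2 := by
    rw [← Real.rpow_natCast N 2, ← Real.rpow_sub hN0]
    norm_num
  rw [div_le_iff₀ (by positivity)] at hsqrt
  rw [hpow, mul_div_assoc', div_mul_eq_mul_div]
  gcongr
  linarith

end remainder

theorem theorem1 (f : ℝ → ℝ) (hf : IsProbDensity f)
    (hcont : ContinuousOn f (Function.support f)) (fmin : ℝ) (hfmin : 0 < fmin) :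
    -- the quantities in the estimates are finite
    volume (superlevel f fmin) < ⊤ ∧
    (∀ a b : ℝ, a < b → Icc a b ⊆ superlevel f fmin →
      IntervalIntegrable (fun x => 1 / f x) volume a b ∧
      ∀ (n : ℕ) (i j : Fin n), i ≠ j → Integrable (leapfrogGiven i j a b) (sampleLaw f n)) ∧
    -- the remainder is `o(1/n)`, uniformly in `a` and `b`
    (∀ ε : ℝ, 0 < ε → ∃ n₀ : ℕ, ∀ n : ℕ, n₀ ≤ n → ∀ i j : Fin n, i ≠ j →
      ∀ a b : ℝ, a < b → Icc a b ⊆ superlevel f fmin →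
        |expectedLeapfrog f n i j a b - 2 / (n : ℝ) * ∫ x in a..b, 1 / f x| ≤ ε * (1 / (n : ℝ))) ∧
    -- the sharper bound on the remainder in the locally Lipschitz case
    (∀ L : ℝ≥0, LocallyLipschitzOnWith L f (superlevel f fmin) →
      ∃ n₀ : ℕ, ∀ n : ℕ, n₀ ≤ n → ∀ i j : Fin n, i ≠ j →
      ∀ a b : ℝ, a < b → Icc a b ⊆ superlevel f fmin →
        |expectedLeapfrog f n i j a b - 2 / (n : ℝ) * ∫ x in a..b, 1 / f x| ≤
          10 * (n : ℝ) ^ (-(3 / 2) : ℝ) * (volume (superlevel f fmin)).toReal ^ 2) := by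
  refine ⟨volume_superlevel_lt_top hf hfmin, fun a b hab hsub => ⟨?_, fun n i j hij =>
    integrable_leapfrogGiven hf hij hab.le⟩, fun ε hε =>
      expectedLeapfrog_sub_isLittleO hf hcont hfmin hε, fun L hL =>
        expectedLeapfrog_sub_le_of_lipschitz hf hfmin hL⟩
  exact intervalIntegrable_one_div hfmin hab.le
    (continuousOn_of_subset_superlevel hcont hfmin hsub) hsub
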